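/- **Setting.** A stratified Lie group (homogeneous Carnot group) is a Lie group $\mathbb G=(\mathbb R^N,\circ)$ with identity $0$, together with a decomposition $\mathbb R^N=\mathbb R^{N_1}\times\cdots\times\mathbb R^{N_k}$, such that for every $\lambda>0$ the dilation $$D_\lambda(x)=(\lambda x^{(1)},\lambda^2x^{(2)},\dots,\lambda^kx^{(k)}),\qquad x^{(i)}\in\mathbb R^{N_i},$$ is an automorphism of $\mathbb G$, and such that the left-invariant vector fields $X_1,\dots,X_{N_1}$ with $X_j(0)=\partial_{x_j}|_0$, together with their iterated commutators, span $\mathbb R^N$ at every point. Its homogeneous dimension is $Q=N_1+2N_2+\cdots+kN_k$, and $dx$ denotes Lebesgue measure. Fix a homogeneous quasi-norm on $\mathbb G$, i.e. a continuous function $|\cdot|:\mathbb G\to[0,\infty)$ with $|x|=0$ if and only if $x=0$, $|x^{-1}|=|x|$, and $|D_\lambda x|=\lambda|x|$ for $\lambda>0$. For an open set $\Omega\subset\mathbb G$, $0<s<1$ and $1\le p<\infty$, put $$[u]_{s,p,\mathbb G}=\Big(\int_{\mathbb G}\int_{\mathbb G}\frac{|u(x)-u(y)|^p}{|y^{-1}\circ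 x|^{Q+ps}}\,dx\,dy\Big)^{1/p},$$ $$X_0^{s,p}(\Omega)=\{u\in L^p(\mathbb G): [u]_{s,p,\mathbb G}<\infty,\ u=0\ \text{a.e. in }\mathbb G\setminus\Omega\},\qquad \|u\|_{X_0^{s,p}(\Omega)}=\|u\|_{L^p(\Omega)}+[u]_{s,p,\mathbb G},$$ where functions are real-valued. **Theorem 1.2.** Let $\mathbb G$ be a stratified Lie group of homogeneous dimension $Q$, with a fixed homogeneous quasi-norm, and let $\Omega\subset\mathbb G$ be open. Let $0<s<1\le p<\infty$ and $ps=Q$. Then $X_0^{s,p}(\Omega)$ embeds continuously into $L^r(\Omega)$ for every $p\le r<\infty$: for each such $r$ there is a constant $C>0$, depending only on $\mathbb G$, the quasi-norm, $s$, $p$, $r$ and $\Omega$, such that $$\|u\|_{L^r(\Omega)}\le C\,\|u\|_{X_0^{s,p}(\Omega)}\qquad\text{for all }u\in X_0^{s,p}(\Omega).$$ If moreover $\Omega$ is bounded, then for every $1\le r<\infty$ the space $X_0^{s,p}(\Omega)$ embeds compactly into $L^r(\Omega)$; that is, the embedding is continuous and every bounded sequence in $X_0^{s,p}(\Omega)$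 has a subsequence that converges in $L^r(\Omega)$. For bounded $\Omega$ the same holds when $X_0^{s,p}(\Omega)$ is equipped with $[u]_{s,p,\mathbb G}$ alone as its norm. -/

import Mathlib

open MeasureTheory Filter Topology
open scoped NNReal ENNReal ContDiff

/-- The iterated commutators of a family `S` of vector fields on a normed space `E`:
the members of `S`, and all Lie brackets of iterated commutators.  The Lie algebra generated by
smooth vector fields is the linear span of these. -/
inductive IteratedCommutator {E : Type*} [NormedAddCommGroup E] [NormedSpace ℝ E]
    (S : Set (E → E)) : (E → E) → Prop
  | basic (V : E → E) (hV : V ∈ S) : IteratedCommutator S V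
  | bracket (V W : E → E) (hV : IteratedCommutator S V) (hW : IteratedCommutator S W) :
      IteratedCommutator S (VectorField.lieBracket ℝ V W)

/-- The anisotropic dilation `D_t(x) = (t ^ w₁ x₁, …, t ^ w_N x_N)` of `ℝ^N` with weights `w`. -/
def weightedDilation {N : ℕ} (w : Fin N → ℕ) (t : ℝ) (x : Fin N → ℝ) : Fin N → ℝ :=
  fun i => t ^ w i * x i

/-- The left-invariant vector field of the group law `m` on `ℝ^N` (with identity `0`) whose value
at `0` is `∂/∂x_j`: at `x` it is the differential at `0` of left translation by `x`, applied to
the `j`-th basis vector. -/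
noncomputable def leftInvariantField {N : ℕ} (m : (Fin N → ℝ) → (Fin N → ℝ) → (Fin N → ℝ))
    (j : Fin N) (x : Fin N → ℝ) : Fin N → ℝ :=
  fderiv ℝ (fun y => m x y) 0 (Pi.single j 1)

/-- A stratified Lie group (homogeneous Carnot group) on `ℝ^N`: a Lie group structure on `ℝ^N`
for which dilations with weights `1, …, 1, 2, …, 2, …, k, …, k` are automorphisms, and whose
left-invariant vector fields in the weight-one directions satisfy Hörmander's condition.
`weight i` is the index of the layer of the `i`-th coordinate, so the layer `ℝ^{N_l}` consists of
the coordinates of weight `l`, and the layers are listed in increasing order. -/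
structure StratifiedLieGroup (N : ℕ) where
  /-- the group law -/
  mul : (Fin N → ℝ) → (Fin N → ℝ) → (Fin N → ℝ)
  /-- the group inverse -/
  inv : (Fin N → ℝ) → (Fin N → ℝ)
  mul_assoc : ∀ x y z, mul (mul x y) z = mul x (mul y z)
  zero_mul : ∀ x, mul 0 x = x
  mul_zero : ∀ x, mul x 0 = x
  inv_mul : ∀ x, mul (inv x) x = 0
  contDiff_mul : ContDiff ℝ ∞ (fun z : (Fin N → ℝ) × (Fin N → ℝ) => mul z.1 z.2)
  contDiff_inv : ContDiff ℝ ∞ inv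
  /-- the weights of the coordinates -/
  weight : Fin N → ℕ
  weight_pos : ∀ i, 1 ≤ weight i
  weight_mono : Monotone weight
  dilation_mul : ∀ t : ℝ, 0 < t → ∀ x y, weightedDilation weight t (mul x y) =
    mul (weightedDilation weight t x) (weightedDilation weight t y)
  hormander : ∀ x : Fin N → ℝ, Submodule.span ℝ
    {v | ∃ V, IteratedCommutator {X | ∃ j, weight j = 1 ∧ X = leftInvariantField mul j} V ∧
      v = V x} = ⊤

namespace StratifiedLieGroup

variable {N : ℕ}

/-- The homogeneous dimension `Q = N₁ + 2 N₂ + ⋯ + k N_k`, the sum of all the weights. -/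
def homogeneousDimension (G : StratifiedLieGroup N) : ℕ := ∑ i, G.weight i

/-- A homogeneous quasi-norm on `G`. -/
structure QuasiNorm (G : StratifiedLieGroup N) where
  /-- the underlying function -/
  toFun : (Fin N → ℝ) → ℝ
  continuous_toFun : Continuous toFun
  nonneg : ∀ x, 0 ≤ toFun x
  eq_zero_iff : ∀ x, toFun x = 0 ↔ x = 0
  map_inv : ∀ x, toFun (G.inv x) = toFun x
  map_dilation : ∀ t : ℝ, 0 < t → ∀ x, toFun (weightedDilation G.weight t x) = t * toFun x

variable (G : StratifiedLieGroup N) (ν : G.QuasiNorm)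

/-- The Gagliardo seminorm
`[u]_{s,p,G} = (∫_G ∫_G |u(x) - u(y)|^p / |y⁻¹ x|^(Q + p s) dx dy) ^ (1/p)`, with values in
`[0, ∞]`.  The Haar measure `dx` is Lebesgue measure on `ℝ^N`. -/
noncomputable def gagliardo (s p : ℝ) (u : (Fin N → ℝ) → ℝ) : ℝ≥0∞ :=
  (∫⁻ y, ∫⁻ x, ENNReal.ofReal (|u x - u y| ^ p /
    ν.toFun (G.mul (G.inv y) x) ^ ((G.homogeneousDimension : ℝ) + p * s))) ^ (1 / p)

/-- The fractional Sobolev space `W^{s,p}(G)` (as a set of functions, not of classes of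
functions modulo equality almost everywhere). -/
def fractionalSobolev (s p : ℝ) : Set ((Fin N → ℝ) → ℝ) :=
  {u | MemLp u (ENNReal.ofReal p) volume ∧ G.gagliardo ν s p u < ⊤}

/-- The space `X_0^{s,p}(Ω)` of the `u ∈ W^{s,p}(G)` that vanish (almost everywhere) outside
`Ω`. -/
def spaceXZero (s p : ℝ) (Ω : Set (Fin N → ℝ)) : Set ((Fin N → ℝ) → ℝ) :=
  {u | u ∈ G.fractionalSobolev ν s p ∧ ∀ᵐ x, x ∉ Ω → u x = 0}

/-- The full norm `‖u‖_{L^p(Ω)} + [u]_{s,p,G}` of `X_0^{s,p}(Ω)`. -/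
noncomputable def normXZero (s p : ℝ) (Ω : Set (Fin N → ℝ)) (u : (Fin N → ℝ) → ℝ) : ℝ≥0∞ :=
  eLpNorm u (ENNReal.ofReal p) (volume.restrict Ω) + G.gagliardo ν s p u

end StratifiedLieGroup

/-- The function space `X` with norm `nrm` embeds continuously into `L^r(Ω)`, by restriction
to `Ω`. -/
def ContinuouslyEmbedsInLp {N : ℕ} (X : Set ((Fin N → ℝ) → ℝ))
    (nrm : ((Fin N → ℝ) → ℝ) → ℝ≥0∞) (r : ℝ) (Ω : Set (Fin N → ℝ)) : Prop :=
  ∃ C : ℝ≥0, 0 < C ∧ ∀ u ∈ X,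
    MemLp u (ENNReal.ofReal r) (volume.restrict Ω) ∧
    eLpNorm u (ENNReal.ofReal r) (volume.restrict Ω) ≤ C * nrm u

/-- The function space `X` with norm `nrm` embeds compactly into `L^r(Ω)`, by restriction to `Ω`:
the embedding is continuous, and every `nrm`-bounded sequence in `X` has a subsequence that
converges in `L^r(Ω)`. -/
def CompactlyEmbedsInLp {N : ℕ} (X : Set ((Fin N → ℝ) → ℝ))
    (nrm : ((Fin N → ℝ) → ℝ) → ℝ≥0∞) (r : ℝ) (Ω : Set (Fin N → ℝ)) : Prop :=
  ContinuouslyEmbedsInLp X nrm r Ω ∧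
  ∀ u : ℕ → (Fin N → ℝ) → ℝ, (∀ n, u n ∈ X) → (∃ M : ℝ≥0, ∀ n, nrm (u n) ≤ M) →
    ∃ v : (Fin N → ℝ) → ℝ, MemLp v (ENNReal.ofReal r) (volume.restrict Ω) ∧
      ∃ φ : ℕ → ℕ, StrictMono φ ∧
        Tendsto (fun n => eLpNorm (u (φ n) - v) (ENNReal.ofReal r) (volume.restrict Ω))
          atTop (𝓝 0)

/-! When `p * s = Q` the kernel is `|y⁻¹x| ^ (-2Q)`, so on a box `U ∋ y` of measure comparable to
`m` it is at least a constant times `m⁻²`. Let `l = |u y| > 0` and let `I` be the integral of `|u| ^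
q`. By Chebyshev, `|u| ≥ l/2` on a set of measure at most `m = I / (l/2) ^ q`. A box around `y` of
measure `2m` therefore contains a set of measure at least `m` on which `|u x - u y| ≥ l/2`, and the
inner Gagliardo integral at `y` is at least `c l ^ p m / m² = c' l ^ (p+q) / I`. This is
`exists_enorm_rpow_add_le_localEnergy`. Integrating in `y` bounds the integral of `|u| ^ (p+q)` by
`C I [u] ^ p`; iterating from `q = p` reaches every multiple of `p`, and interpolation gives all `r
≥ p`.

For compactness, `u` is replaced on a bounded `Ω` by its averages over finitely many small boxes.
The error in `L^p(Ω)` is uniformly small on sets bounded in the seminorm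
(`exists_simpleFunc_eLpNorm_sub_average_le`), and the averages form bounded finite vectors. This
gives subsequences Cauchy in `L^p`, hence in `L^r` by interpolation with a bounded higher norm. For
the seminorm alone, the Poincaré inequality comes from comparing `u` with its zero values on a ball
outside `Ω`.

The geometry enters through two facts: boxes have measure proportional to `ρ ^ Q`, and the
quasi-norm of `y⁻¹x` is `O(ρ)` for `x`, `y` in a common box. -/

/-! ### Anisotropic dilations. -/

section WeightedDilation

variable {N : ℕ} (w : Fin N → ℕ)

/-- The dilation `weightedDilation w t` as a continuous linear map. -/
noncomputable def weightedDilationCLM (t : ℝ) : (Fin N → ℝ) →L[ℝ] (Fin N → ℝ) :=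
  LinearMap.toContinuousLinearMap (Matrix.toLin' (Matrix.diagonal fun i => t ^ w i))

theorem weightedDilationCLM_apply (t : ℝ) (x : Fin N → ℝ) :
    weightedDilationCLM w t x = weightedDilation w t x := by
  ext i
  simp [weightedDilationCLM, weightedDilation, Matrix.mulVec_diagonal]

theorem continuous_weightedDilation (t : ℝ) : Continuous (weightedDilation w t) := by
  unfold weightedDilation
  fun_prop

theorem weightedDilation_zero_right (t : ℝ) : weightedDilation w t (0 : Fin N → ℝ) = 0 := by
  ext i
  simp [weightedDilation]

theorem weightedDilation_single (t : ℝ) (j : Fin N) :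
    weightedDilation w t (Pi.single j 1) = t ^ w j • (Pi.single j 1 : Fin N → ℝ) := by
  ext i
  by_cases h : i = j
  · subst h
    simp [weightedDilation]
  · simp [weightedDilation, h]

theorem tendsto_weightedDilation_zero (hw : ∀ i, 1 ≤ w i) (x : Fin N → ℝ) :
    Tendsto (fun t : ℝ => weightedDilation w t x) (𝓝[>] 0) (𝓝 0) := by
  have hc : Continuous fun t : ℝ => weightedDilation w t x := by
    unfold weightedDilation
    fun_prop
  have h0 : weightedDilation w 0 x = 0 := by
    ext i
    simp [weightedDilation, Nat.one_le_iff_ne_zero.mp (hw i)]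
  exact h0 ▸ (hc.tendsto 0).mono_left nhdsWithin_le_nhds

theorem volume_preimage_weightedDilation_inv {ρ : ℝ} (hρ : 0 < ρ) (A : Set (Fin N → ℝ)) :
    volume (weightedDilation w ρ⁻¹ ⁻¹' A) = ENNReal.ofReal (ρ ^ ∑ i, w i) * volume A := by
  have hdet : LinearMap.det (Matrix.toLin' (Matrix.diagonal fun i => ρ⁻¹ ^ w i)) =
      (ρ ^ ∑ i, w i)⁻¹ := by
    rw [LinearMap.det_toLin', Matrix.det_diagonal, Finset.prod_pow_eq_pow_sum, inv_pow]
  have hpos : 0 < ρ ^ ∑ i, w i := pow_pos hρ _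
  have h := Measure.addHaar_preimage_linearMap (volume : Measure (Fin N → ℝ))
    (f := Matrix.toLin' (Matrix.diagonal fun i => ρ⁻¹ ^ w i))
    (by rw [hdet]; exact (inv_pos.mpr hpos).ne') A
  rw [hdet, inv_inv, abs_of_pos hpos] at h
  have hfun : weightedDilation w ρ⁻¹ = Matrix.toLin' (Matrix.diagonal fun i => ρ⁻¹ ^ w i) :=
    funext fun x => (weightedDilationCLM_apply w ρ⁻¹ x).symm
  rw [← h, hfun]

end WeightedDilation

/-! ### Group identities, invariance of Lebesgue measure, and boxes. -/

namespace StratifiedLieGroup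

variable {N : ℕ} (G : StratifiedLieGroup N)

theorem mul_inv (x : Fin N → ℝ) : G.mul x (G.inv x) = 0 := by
  have h : G.mul (G.mul (G.inv (G.inv x)) (G.inv x)) (G.mul x (G.inv x)) = 0 := by
    rw [G.mul_assoc, ← G.mul_assoc (G.inv x), G.inv_mul, G.zero_mul, G.inv_mul]
  rwa [G.inv_mul, G.zero_mul] at h

theorem inv_mul_cancel_left (x y : Fin N → ℝ) : G.mul (G.inv x) (G.mul x y) = y := by
  rw [← G.mul_assoc, G.inv_mul, G.zero_mul]

theorem mul_inv_cancel_left (x y : Fin N → ℝ) : G.mul x (G.mul (G.inv x) y) = y := by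
  rw [← G.mul_assoc, G.mul_inv, G.zero_mul]

theorem eq_inv_of_mul_eq_zero {x y : Fin N → ℝ} (h : G.mul x y = 0) : x = G.inv y := by
  rw [← G.mul_zero x, ← G.mul_inv y, ← G.mul_assoc, h, G.zero_mul]

theorem inv_inv (x : Fin N → ℝ) : G.inv (G.inv x) = x :=
  (G.eq_inv_of_mul_eq_zero (G.mul_inv x)).symm

theorem inv_mul_rev (x y : Fin N → ℝ) : G.inv (G.mul x y) = G.mul (G.inv y) (G.inv x) := by
  refine (G.eq_inv_of_mul_eq_zero ?_).symm
  rw [G.mul_assoc, G.inv_mul_cancel_left, G.inv_mul]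

theorem eq_of_inv_mul_eq_zero {x y : Fin N → ℝ} (h : G.mul (G.inv y) x = 0) : x = y := by
  rw [← G.mul_inv_cancel_left y x, h, G.mul_zero]

theorem dilation_inv {t : ℝ} (ht : 0 < t) (x : Fin N → ℝ) :
    weightedDilation G.weight t (G.inv x) = G.inv (weightedDilation G.weight t x) := by
  apply G.eq_inv_of_mul_eq_zero
  rw [← G.dilation_mul t ht, G.inv_mul, weightedDilation_zero_right]

theorem continuous_mul : Continuous fun z : (Fin N → ℝ) × (Fin N → ℝ) => G.mul z.1 z.2 :=
  G.contDiff_mul.continuous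

theorem continuous_mul_left (a : Fin N → ℝ) : Continuous (G.mul a) :=
  G.continuous_mul.comp (Continuous.prodMk_right a)

theorem continuous_inv_mul :
    Continuous fun z : (Fin N → ℝ) × (Fin N → ℝ) => G.mul (G.inv z.1) z.2 :=
  G.continuous_mul.comp
    ((G.contDiff_inv.continuous.comp continuous_fst).prodMk continuous_snd)

theorem hasFDerivAt_mul (z : (Fin N → ℝ) × (Fin N → ℝ)) :
    HasFDerivAt (fun z : (Fin N → ℝ) × (Fin N → ℝ) => G.mul z.1 z.2)
      (fderiv ℝ (fun z : (Fin N → ℝ) × (Fin N → ℝ) => G.mul z.1 z.2) z) z :=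
  (G.contDiff_mul.differentiable (by simp) z).hasFDerivAt

/-- The differential at `x` of the left translation by `a`. -/
noncomputable def leftDeriv (a x : Fin N → ℝ) : (Fin N → ℝ) →L[ℝ] (Fin N → ℝ) :=
  (fderiv ℝ (fun z : (Fin N → ℝ) × (Fin N → ℝ) => G.mul z.1 z.2) (a, x)).comp
    (ContinuousLinearMap.inr ℝ _ _)

theorem hasFDerivAt_mul_left (a x : Fin N → ℝ) :
    HasFDerivAt (G.mul a) (G.leftDeriv a x) x :=
  (G.hasFDerivAt_mul (a, x)).comp x (hasFDerivAt_prodMk_right a x)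

theorem continuous_leftDeriv :
    Continuous fun z : (Fin N → ℝ) × (Fin N → ℝ) => G.leftDeriv z.1 z.2 :=
  (G.contDiff_mul.continuous_fderiv (by simp)).clm_comp continuous_const

theorem leftDeriv_zero_left (x : Fin N → ℝ) : G.leftDeriv 0 x = ContinuousLinearMap.id ℝ _ := by
  refine (G.hasFDerivAt_mul_left 0 x).unique ?_
  have : G.mul 0 = id := funext G.zero_mul
  rw [this]
  exact hasFDerivAt_id x

theorem leftDeriv_dilation {t : ℝ} (ht : 0 < t) (a x v : Fin N → ℝ) :
    G.leftDeriv (weightedDilation G.weight t a) (weightedDilation G.weight t x)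
      (weightedDilation G.weight t v) = weightedDilation G.weight t (G.leftDeriv a x v) := by
  have hD : ∀ y, HasFDerivAt (weightedDilation G.weight t) (weightedDilationCLM G.weight t) y := by
    intro y
    have := (weightedDilationCLM G.weight t).hasFDerivAt (x := y)
    simpa only [← funext (weightedDilationCLM_apply G.weight t)] using this
  have h1 := (G.hasFDerivAt_mul_left (weightedDilation G.weight t a)
    (weightedDilation G.weight t x)).comp x (hD x)
  have h2 := (hD (G.mul a x)).comp x (G.hasFDerivAt_mul_left a x)
  have heq : weightedDilation G.weight t ∘ G.mul a =
      G.mul (weightedDilation G.weight t a) ∘ weightedDilation G.weight t :=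
    funext fun y => G.dilation_mul t ht a y
  rw [heq] at h2
  have := congrArg (fun L => L v) (h1.unique h2)
  simpa only [ContinuousLinearMap.comp_apply, weightedDilationCLM_apply] using this

/-- By dilation covariance, the entry at the dilated points times `t ^ (w j - w i)` does not depend
on `t > 0`. As `t → 0` both points tend to the origin, where the derivative is the identity. The
convention `0 ^ 0 = 1` keeps the case of equal weights in the same formula. -/
theorem leftDeriv_single_of_weight_le (a x : Fin N → ℝ) {i j : Fin N}
    (hij : G.weight i ≤ G.weight j) :
    G.leftDeriv a x (Pi.single j 1) i =
      0 ^ (G.weight j - G.weight i) * (Pi.single j 1 : Fin N → ℝ) i := by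
  have hscale : ∀ t : ℝ, 0 < t → t ^ (G.weight j - G.weight i) *
      G.leftDeriv (weightedDilation G.weight t a) (weightedDilation G.weight t x)
        (Pi.single j 1) i = G.leftDeriv a x (Pi.single j 1) i := by
    intro t ht
    have h := congrFun (G.leftDeriv_dilation ht a x (Pi.single j 1)) i
    rw [weightedDilation_single, map_smul, Pi.smul_apply, smul_eq_mul] at h
    simp only [weightedDilation] at h
    have hpow : t ^ G.weight j = t ^ G.weight i * t ^ (G.weight j - G.weight i) := by
      rw [← pow_add, Nat.add_sub_cancel' hij]
    rw [hpow, _root_.mul_assoc] at h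
    exact mul_left_cancel₀ (pow_pos ht _).ne' h
  have hlim : Tendsto (fun t : ℝ => t ^ (G.weight j - G.weight i) *
      G.leftDeriv (weightedDilation G.weight t a) (weightedDilation G.weight t x)
        (Pi.single j 1) i) (𝓝[>] 0)
      (𝓝 (0 ^ (G.weight j - G.weight i) * G.leftDeriv 0 0 (Pi.single j 1) i)) := by
    refine Tendsto.mul (((continuous_pow _).tendsto 0).mono_left nhdsWithin_le_nhds) ?_
    have hc : Continuous fun z : (Fin N → ℝ) × (Fin N → ℝ) =>
        G.leftDeriv z.1 z.2 (Pi.single j 1) i :=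
      (continuous_apply i).comp (G.continuous_leftDeriv.clm_apply continuous_const)
    exact (hc.tendsto (0, 0)).comp
      ((tendsto_weightedDilation_zero G.weight G.weight_pos a).prodMk_nhds
        (tendsto_weightedDilation_zero G.weight G.weight_pos x))
  have hconst : Tendsto (fun t : ℝ => t ^ (G.weight j - G.weight i) *
      G.leftDeriv (weightedDilation G.weight t a) (weightedDilation G.weight t x)
        (Pi.single j 1) i) (𝓝[>] 0) (𝓝 (G.leftDeriv a x (Pi.single j 1) i)) := by
    refine tendsto_const_nhds.congr' ?_
    filter_upwards [self_mem_nhdsWithin] with t ht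
    exact (hscale t ht).symm
  rw [tendsto_nhds_unique hconst hlim, G.leftDeriv_zero_left]
  rfl

theorem det_leftDeriv (a x : Fin N → ℝ) : (G.leftDeriv a x).det = 1 := by
  have hM : (G.leftDeriv a x).det =
      (LinearMap.toMatrix' (G.leftDeriv a x : (Fin N → ℝ) →ₗ[ℝ] (Fin N → ℝ))).det :=
    (LinearMap.det_toMatrix' _).symm
  -- Since the weights are nondecreasing, the entry formula covers all `i ≤ j`: it gives ones on the
  -- diagonal and zeros above it.
  rw [hM, Matrix.det_of_isLowerTriangular]
  · refine Finset.prod_eq_one fun i _ => ?_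
    rw [LinearMap.toMatrix'_apply]
    have := G.leftDeriv_single_of_weight_le a x (le_refl (G.weight i))
    simpa using this
  · intro i j hij
    have hij' : i < j := hij
    rw [LinearMap.toMatrix'_apply]
    have := G.leftDeriv_single_of_weight_le a x (G.weight_mono hij'.le)
    simpa [hij'.ne] using this

/-- Lebesgue measure is invariant under left translations. -/
theorem volume_preimage_mul_left (a : Fin N → ℝ) {A : Set (Fin N → ℝ)} (hA : MeasurableSet A) :
    volume (G.mul (G.inv a) ⁻¹' A) = volume A := by
  have himg : G.mul (G.inv a) ⁻¹' A = G.mul a '' A := by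
    ext y
    constructor
    · intro hy
      exact ⟨_, hy, G.mul_inv_cancel_left a y⟩
    · rintro ⟨x, hx, rfl⟩
      simpa only [Set.mem_preimage, G.inv_mul_cancel_left] using hx
  have hinj : Set.InjOn (G.mul a) A := fun x _ y _ h => by
    rw [← G.inv_mul_cancel_left a x, ← G.inv_mul_cancel_left a y]
    exact congrArg _ h
  have h := lintegral_abs_det_fderiv_eq_addHaar_image volume hA
    (fun x _ => (G.hasFDerivAt_mul_left a x).hasFDerivWithinAt) hinj
  rw [himg, ← h]
  simp [G.det_leftDeriv]

/-- The left translate by `c` of the dilation by `ρ` of the Euclidean (supremum norm) unit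
ball. -/
def unitBox (c : Fin N → ℝ) (ρ : ℝ) : Set (Fin N → ℝ) :=
  {x | weightedDilation G.weight ρ⁻¹ (G.mul (G.inv c) x) ∈ Metric.ball 0 1}

theorem isOpen_unitBox (c : Fin N → ℝ) (ρ : ℝ) : IsOpen (G.unitBox c ρ) :=
  Metric.isOpen_ball.preimage
    ((continuous_weightedDilation G.weight ρ⁻¹).comp (G.continuous_mul_left (G.inv c)))

theorem self_mem_unitBox (c : Fin N → ℝ) (ρ : ℝ) : c ∈ G.unitBox c ρ := by
  simp [unitBox, G.inv_mul, weightedDilation_zero_right]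

theorem volume_unitBox (c : Fin N → ℝ) {ρ : ℝ} (hρ : 0 < ρ) :
    volume (G.unitBox c ρ) = ENNReal.ofReal (ρ ^ G.homogeneousDimension *
      volume.real (Metric.ball (0 : Fin N → ℝ) 1)) := by
  have h := G.volume_preimage_mul_left c
    (A := weightedDilation G.weight ρ⁻¹ ⁻¹' Metric.ball 0 1)
    ((continuous_weightedDilation G.weight ρ⁻¹).measurable measurableSet_ball)
  rw [volume_preimage_weightedDilation_inv G.weight hρ] at h
  rw [ENNReal.ofReal_mul (by positivity), Measure.real,
    ENNReal.ofReal_toReal measure_ball_lt_top.ne]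
  exact h

theorem volume_real_ball_pos : 0 < volume.real (Metric.ball (0 : Fin N → ℝ) 1) :=
  ENNReal.toReal_pos (Metric.measure_ball_pos _ _ one_pos).ne' measure_ball_lt_top.ne

variable {G} (ν : G.QuasiNorm)

/-- Left invariance and homogeneity reduce the bound to `c = 0`, `ρ = 1`, where it is continuity on
a compact set. It serves in place of a quasi-triangle inequality. -/
theorem QuasiNorm.exists_bound_unitBox :
    ∃ M : ℝ, 0 < M ∧ ∀ (c : Fin N → ℝ) (ρ : ℝ), 0 < ρ → ∀ x ∈ G.unitBox c ρ,
      ∀ y ∈ G.unitBox c ρ, ν.toFun (G.mul (G.inv y) x) ≤ M * ρ := by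
  have hcont : Continuous fun z : (Fin N → ℝ) × (Fin N → ℝ) =>
      ν.toFun (G.mul (G.inv z.1) z.2) := ν.continuous_toFun.comp G.continuous_inv_mul
  obtain ⟨M, hM⟩ := ((isCompact_closedBall (0 : Fin N → ℝ) 1).prod
    (isCompact_closedBall (0 : Fin N → ℝ) 1)).bddAbove_image hcont.continuousOn
  refine ⟨max M 1, by positivity, fun c ρ hρ x hx y hy => ?_⟩
  have hρ' : 0 < ρ⁻¹ := inv_pos.mpr hρ
  have hmem := hM (Set.mem_image_of_mem _ (Set.mk_mem_prod
    (Metric.ball_subset_closedBall hy) (Metric.ball_subset_closedBall hx)))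
  simp only at hmem
  rw [← G.dilation_inv hρ', ← G.dilation_mul _ hρ', G.inv_mul_rev, G.inv_inv, G.mul_assoc,
    G.mul_inv_cancel_left, ν.map_dilation _ hρ', inv_mul_le_iff₀ hρ] at hmem
  rw [mul_comm]
  exact hmem.trans (mul_le_mul_of_nonneg_left (le_max_left _ _) hρ.le)

end StratifiedLieGroup

/-! ### Interpolation and integral forms of norms. -/

/-- Hölder's inequality applied to `|u| ^ p` and `|u| ^ m`, with weights that write `r` as a convex
combination of `p` and `m`. -/
theorem lintegral_enorm_rpow_interpolate {α : Type*} [MeasurableSpace α] {μ : Measure α}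
    {u : α → ℝ} (hu : AEMeasurable u μ) {p r m : ℝ} (hp : 0 ≤ p) (hpr : p ≤ r) (hrm : r ≤ m)
    (hpm : p < m) :
    ∫⁻ x, ‖u x‖ₑ ^ r ∂μ ≤ (∫⁻ x, ‖u x‖ₑ ^ p ∂μ) ^ ((m - r) / (m - p)) *
      (∫⁻ x, ‖u x‖ₑ ^ m ∂μ) ^ ((r - p) / (m - p)) := by
  have hd : 0 < m - p := sub_pos.mpr hpm
  have hα : 0 ≤ (m - r) / (m - p) := div_nonneg (sub_nonneg.mpr hrm) hd.le
  have hβ : 0 ≤ (r - p) / (m - p) := div_nonneg (sub_nonneg.mpr hpr) hd.le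
  refine le_trans (le_of_eq (lintegral_congr fun x => ?_))
    (ENNReal.lintegral_mul_norm_pow_le (hu.enorm.pow_const p) (hu.enorm.pow_const m) hα hβ
      (by field_simp; ring))
  rw [← ENNReal.rpow_mul, ← ENNReal.rpow_mul, ← ENNReal.rpow_add_of_nonneg _ _
    (mul_nonneg hp hα) (mul_nonneg (hp.trans hpm.le) hβ)]
  congr 1
  field_simp
  ring

theorem eLpNorm_rpow_eq_lintegral {α : Type*} [MeasurableSpace α] {μ : Measure α}
    (u : α → ℝ) {p : ℝ} (hp : 0 < p) :
    eLpNorm u (ENNReal.ofReal p) μ ^ p = ∫⁻ x, ‖u x‖ₑ ^ p ∂μ := by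
  rw [eLpNorm_eq_lintegral_rpow_enorm_toReal (by simpa using hp) ENNReal.ofReal_ne_top,
    ENNReal.toReal_ofReal hp.le, ← ENNReal.rpow_mul, one_div_mul_cancel hp.ne', ENNReal.rpow_one]

theorem Real.enorm_rpow_eq_ofReal (x : ℝ) {p : ℝ} (hp : 0 ≤ p) :
    ‖x‖ₑ ^ p = ENNReal.ofReal (|x| ^ p) := by
  rw [Real.enorm_eq_ofReal_abs, ENNReal.ofReal_rpow_of_nonneg (abs_nonneg x) hp]

/-! ### Higher integrability from the Gagliardo seminorm. -/

namespace StratifiedLieGroup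

variable {N : ℕ} {G : StratifiedLieGroup N} (ν : G.QuasiNorm)

/-- The inner integral of the Gagliardo seminorm. -/
noncomputable def localEnergy (s p : ℝ) (u : (Fin N → ℝ) → ℝ) (y : Fin N → ℝ) : ℝ≥0∞ :=
  ∫⁻ x, ENNReal.ofReal (|u x - u y| ^ p /
    ν.toFun (G.mul (G.inv y) x) ^ ((G.homogeneousDimension : ℝ) + p * s))

theorem lintegral_localEnergy {s p : ℝ} (hp : 0 < p) (u : (Fin N → ℝ) → ℝ) :
    ∫⁻ y, localEnergy ν s p u y = G.gagliardo ν s p u ^ p := by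
  unfold gagliardo localEnergy
  rw [← ENNReal.rpow_mul, one_div_mul_cancel hp.ne', ENNReal.rpow_one]

theorem setLIntegral_enorm_sub_rpow_le_localEnergy {s p : ℝ} (hs : 0 ≤ s) (hp : 0 < p)
    (u : (Fin N → ℝ) → ℝ) (y : Fin N → ℝ) {A : Set (Fin N → ℝ)} (hA : MeasurableSet A) {K : ℝ}
    (hK : 0 < K) (hAK : ∀ x ∈ A, ν.toFun (G.mul (G.inv y) x) ≤ K) :
    ∫⁻ x in A, ‖u x - u y‖ₑ ^ p ≤
      ENNReal.ofReal (K ^ ((G.homogeneousDimension : ℝ) + p * s)) * localEnergy ν s p u y := by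
  have ha : 0 ≤ (G.homogeneousDimension : ℝ) + p * s := by positivity
  unfold localEnergy
  rw [← lintegral_const_mul' _ _ ENNReal.ofReal_ne_top]
  refine (setLIntegral_mono' hA fun x hx => ?_).trans (setLIntegral_le_lintegral A _)
  rw [Real.enorm_rpow_eq_ofReal _ hp.le, ← ENNReal.ofReal_mul (by positivity)]
  apply ENNReal.ofReal_le_ofReal
  have hnonneg := ν.nonneg (G.mul (G.inv y) x)
  -- If the quasi-norm vanishes then `x = y`, and both numerators are zero, so division by zero is
  -- harmless.
  rcases hnonneg.eq_or_lt with h0 | hpos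
  · have hxy := G.eq_of_inv_mul_eq_zero ((ν.eq_zero_iff _).mp h0.symm)
    subst hxy
    simp [Real.zero_rpow hp.ne']
  · rw [← mul_div_assoc, le_div_iff₀ (Real.rpow_pos_of_pos hpos _), mul_comm]
    exact mul_le_mul_of_nonneg_right (Real.rpow_le_rpow hnonneg (hAK x hx) ha) (by positivity)

/-- A large value at `y` forces oscillation in a box around `y`, because `u` is small on at least
half of a box whose size is dictated by Chebyshev. Only when the integral of `|u| ^ q` vanishes is
an exceptional null set needed. -/
theorem exists_enorm_rpow_add_le_localEnergy {s p q : ℝ} (hs : 0 < s) (hp : 0 < p) (hq : 0 < q)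
    (hQ : p * s = (G.homogeneousDimension : ℝ)) :
    ∃ C : ℝ≥0, ∀ u : (Fin N → ℝ) → ℝ, AEMeasurable u → ∫⁻ x, ‖u x‖ₑ ^ q ≠ ⊤ →
      ∀ᵐ y, ‖u y‖ₑ ^ (p + q) ≤ C * (∫⁻ x, ‖u x‖ₑ ^ q) * localEnergy ν s p u y := by
  obtain ⟨M, hM, hMν⟩ := ν.exists_bound_unitBox
  have hV : 0 < volume.real (Metric.ball (0 : Fin N → ℝ) 1) := volume_real_ball_pos
  set V := volume.real (Metric.ball (0 : Fin N → ℝ) 1) with hVdef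
  set Q := G.homogeneousDimension with hQdef
  have hQ0 : Q ≠ 0 := by
    have : (0 : ℝ) < Q := hQ ▸ mul_pos hp hs
    exact_mod_cast this.ne'
  refine ⟨Real.toNNReal (2 ^ (p + q) * (4 * (M ^ Q) ^ 2 / V ^ 2)), fun u hu hfin => ?_⟩
  by_cases hI : ∫⁻ x, ‖u x‖ₑ ^ q = 0
  · rw [lintegral_eq_zero_iff' (hu.enorm.pow_const q)] at hI
    filter_upwards [hI] with y hy
    have hy0 : ‖u y‖ₑ = 0 := by
      simpa [ENNReal.rpow_eq_zero_iff, hq, hq.le, not_lt.mpr hq.le] using hy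
    rw [hy0, ENNReal.zero_rpow_of_pos (add_pos hp hq)]
    exact zero_le
  refine ae_of_all _ fun y => ?_
  by_cases huy : u y = 0
  · rw [huy, enorm_zero, ENNReal.zero_rpow_of_pos (add_pos hp hq)]
    exact zero_le
  set I := ∫⁻ x, ‖u x‖ₑ ^ q with hIdef
  have hi : 0 < I.toReal := ENNReal.toReal_pos hI hfin
  have hIi : I = ENNReal.ofReal I.toReal := (ENNReal.ofReal_toReal hfin).symm
  set i := I.toReal
  have hl : 0 < |u y| := abs_pos.mpr huy
  set l := |u y| with hldef
  have hlq : 0 < (l / 2) ^ q := by positivity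
  set m := i / (l / 2) ^ q with hm
  have hmpos : 0 < m := by positivity
  -- This radius gives the box measure `2m`, twice the Chebyshev bound for the set `|u| ≥ l/2`.
  set ρ := (2 * m / V) ^ ((Q : ℝ)⁻¹) with hρdef
  have hρ : 0 < ρ := by positivity
  have hρQ : ρ ^ Q = 2 * m / V := Real.rpow_inv_natCast_pow (by positivity) hQ0
  set U := G.unitBox y ρ with hU
  have hUm : MeasurableSet U := (G.isOpen_unitBox y ρ).measurableSet
  have hvolU : volume U = ENNReal.ofReal m + ENNReal.ofReal m := by
    rw [hU, G.volume_unitBox y hρ, hρQ, ← ENNReal.ofReal_add hmpos.le hmpos.le]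
    congr 1
    rw [← hVdef]
    field_simp
    ring
  have hlarge : volume {x | ENNReal.ofReal ((l / 2) ^ q) ≤ ‖u x‖ₑ ^ q} ≤ ENNReal.ofReal m := by
    have h := mul_meas_ge_le_lintegral₀ (hu.enorm.pow_const q) (ENNReal.ofReal ((l / 2) ^ q))
    rw [hm, ENNReal.ofReal_div_of_pos hlq, ← hIi, ENNReal.le_div_iff_mul_le
      (Or.inl (by simpa using hlq)) (Or.inl ENNReal.ofReal_ne_top), mul_comm]
    exact h
  have hcover : U ⊆ {x | ENNReal.ofReal ((l / 2) ^ q) ≤ ‖u x‖ₑ ^ q} ∪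
      ({x | ENNReal.ofReal ((l / 2) ^ p) ≤ ‖u x - u y‖ₑ ^ p} ∩ U) := by
    intro x hx
    rcases le_or_gt (l / 2) |u x| with h | h
    · left
      rw [Set.mem_ofPred_eq, Real.enorm_rpow_eq_ofReal _ hq.le]
      exact ENNReal.ofReal_le_ofReal (Real.rpow_le_rpow (by positivity) h hq.le)
    · right
      refine ⟨?_, hx⟩
      rw [Set.mem_ofPred_eq, Real.enorm_rpow_eq_ofReal _ hp.le]
      refine ENNReal.ofReal_le_ofReal (Real.rpow_le_rpow (by positivity) ?_ hp.le)
      have := abs_sub_abs_le_abs_sub (u y) (u x)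
      rw [abs_sub_comm] at this
      linarith
  have hsmall : ENNReal.ofReal m ≤
      volume.restrict U {x | ENNReal.ofReal ((l / 2) ^ p) ≤ ‖u x - u y‖ₑ ^ p} := by
    rw [Measure.restrict_apply' hUm]
    have h := (measure_mono hcover).trans (measure_union_le (μ := volume) _ _)
    rw [hvolU] at h
    exact (ENNReal.add_le_add_iff_left ENNReal.ofReal_ne_top).mp
      (h.trans (add_le_add_left hlarge _))
  have hmarkov : ENNReal.ofReal ((l / 2) ^ p) * ENNReal.ofReal m ≤
      ENNReal.ofReal (((M ^ Q) * (2 * m / V)) ^ 2) * localEnergy ν s p u y := by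
    have h := mul_meas_ge_le_lintegral₀ (μ := volume.restrict U)
      (((hu.sub_const (u y)).enorm.pow_const p).restrict) (ENNReal.ofReal ((l / 2) ^ p))
    have h2 := setLIntegral_enorm_sub_rpow_le_localEnergy ν hs.le hp u y hUm (mul_pos hM hρ)
      (fun x hx => hMν y ρ hρ x hx y (G.self_mem_unitBox y ρ))
    -- Here criticality enters: the kernel exponent is `2Q`, so the kernel bound is the square of
    -- `(M * ρ) ^ Q`.
    rw [hQ, Real.rpow_add (mul_pos hM hρ), Real.rpow_natCast, ← hQdef, _root_.mul_pow, hρQ,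
      ← sq] at h2
    exact (mul_le_mul_right hsmall _).trans (h.trans h2)
  -- This factor turns `(l/2) ^ p * m` into `l ^ (p+q)`; on the other side one power of `m` is left,
  -- and `(l/2) ^ q * m` is the integral of `|u| ^ q`.
  have hk : 0 ≤ 2 ^ (p + q) * (l / 2) ^ q / m := by positivity
  have hmain := mul_le_mul_right hmarkov (ENNReal.ofReal (2 ^ (p + q) * (l / 2) ^ q / m))
  have hleft : ENNReal.ofReal (2 ^ (p + q) * (l / 2) ^ q / m) *
      (ENNReal.ofReal ((l / 2) ^ p) * ENNReal.ofReal m) = ‖u y‖ₑ ^ (p + q) := by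
    rw [← ENNReal.ofReal_mul (by positivity), ← ENNReal.ofReal_mul hk,
      Real.enorm_rpow_eq_ofReal _ (by positivity)]
    congr 1
    have h2 : l ^ (p + q) = 2 ^ (p + q) * ((l / 2) ^ p * (l / 2) ^ q) := by
      rw [← Real.rpow_add (by positivity), ← Real.mul_rpow (by positivity) (by positivity)]
      congr 1
      ring
    rw [← hldef, h2]
    field_simp
  have hright : ENNReal.ofReal (2 ^ (p + q) * (l / 2) ^ q / m) *
      (ENNReal.ofReal (((M ^ Q) * (2 * m / V)) ^ 2) * localEnergy ν s p u y) =
      (Real.toNNReal (2 ^ (p + q) * (4 * (M ^ Q) ^ 2 / V ^ 2)) : ℝ≥0) * I *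
        localEnergy ν s p u y := by
    rw [← _root_.mul_assoc, ← ENNReal.ofReal_mul hk, hIi, ← ENNReal.ofReal.eq_1,
      ← ENNReal.ofReal_mul (by positivity)]
    congr 2
    rw [hm]
    field_simp
    ring
  rw [hleft, hright] at hmain
  exact hmain

theorem exists_lintegral_enorm_rpow_add_le {s p q : ℝ} (hs : 0 < s) (hp : 0 < p) (hq : 0 < q)
    (hQ : p * s = (G.homogeneousDimension : ℝ)) :
    ∃ C : ℝ≥0, ∀ u : (Fin N → ℝ) → ℝ, AEMeasurable u → ∫⁻ x, ‖u x‖ₑ ^ q ≠ ⊤ →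
      ∫⁻ y, ‖u y‖ₑ ^ (p + q) ≤ C * (∫⁻ x, ‖u x‖ₑ ^ q) * G.gagliardo ν s p u ^ p := by
  obtain ⟨C, hC⟩ := exists_enorm_rpow_add_le_localEnergy ν hs hp hq hQ
  refine ⟨C, fun u hu hfin => (lintegral_mono_ae (hC u hu hfin)).trans ?_⟩
  rw [lintegral_const_mul' _ _ (ENNReal.mul_ne_top ENNReal.coe_ne_top hfin),
    lintegral_localEnergy ν hp]

/-- Each application of the previous estimate raises the exponent by `p`. The single bound `T` for
both norms keeps the right side homogeneous, and the induction supplies the finiteness needed for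
the next application. -/
theorem exists_lintegral_enorm_rpow_nat_mul_le {s p : ℝ} (hs : 0 < s) (hp : 0 < p)
    (hQ : p * s = (G.homogeneousDimension : ℝ)) (k : ℕ) :
    ∃ C : ℝ≥0, ∀ u : (Fin N → ℝ) → ℝ, AEMeasurable u → ∀ T : ℝ≥0∞, T ≠ ⊤ →
      ∫⁻ x, ‖u x‖ₑ ^ p ≤ T ^ p → G.gagliardo ν s p u ≤ T →
      ∫⁻ x, ‖u x‖ₑ ^ ((k + 1) * p) ≤ C * T ^ ((k + 1) * p) := by
  induction k with
  | zero => exact ⟨1, fun u _ T _ h _ => by simpa using h⟩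
  | succ k ih =>
    obtain ⟨C, hC⟩ := ih
    have hkp : 0 < (k + 1) * p := by positivity
    obtain ⟨C', hC'⟩ := exists_lintegral_enorm_rpow_add_le ν hs hp hkp hQ
    refine ⟨C' * C, fun u hu T hT h1 h2 => ?_⟩
    have hk := hC u hu T hT h1 h2
    have hfin : ∫⁻ x, ‖u x‖ₑ ^ ((k + 1) * p) ≠ ⊤ := ne_top_of_le_ne_top
      (ENNReal.mul_ne_top ENNReal.coe_ne_top (ENNReal.rpow_ne_top_of_nonneg hkp.le hT)) hk
    have hexp : ((k + 1 : ℕ) + 1) * p = p + (k + 1) * p := by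
      push_cast
      ring
    rw [hexp, ENNReal.rpow_add_of_nonneg _ _ hp.le hkp.le, mul_comm (T ^ p), ENNReal.coe_mul]
    calc _ ≤ _ := hC' u hu hfin
      _ ≤ C' * (C * T ^ ((k + 1) * p)) * T ^ p := by gcongr
      _ = _ := by ring

theorem exists_eLpNorm_le {s p r : ℝ} (hs : 0 < s) (hp : 0 < p)
    (hQ : p * s = (G.homogeneousDimension : ℝ)) (hr : p ≤ r) :
    ∃ C : ℝ≥0, ∀ u : (Fin N → ℝ) → ℝ, AEMeasurable u →
      eLpNorm u (ENNReal.ofReal r) volume ≤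
        C * (eLpNorm u (ENNReal.ofReal p) volume + G.gagliardo ν s p u) := by
  have hr0 : 0 < r := hp.trans_le hr
  obtain ⟨k, hk⟩ := exists_nat_gt (r / p)
  rw [div_lt_iff₀ hp] at hk
  obtain ⟨C, hC⟩ := exists_lintegral_enorm_rpow_nat_mul_le ν hs hp hQ k
  set m := ((k : ℝ) + 1) * p with hm
  have hrm : r < m := by
    rw [hm]
    linarith
  have hpm : p < m := hr.trans_lt hrm
  have hm0 : 0 < m := hp.trans hpm
  clear_value m
  set β := (r - p) / (m - p) with hβ
  have hd : 0 < m - p := sub_pos.mpr hpm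
  have hα0 : 0 ≤ (m - r) / (m - p) := div_nonneg (sub_nonneg.mpr hrm.le) hd.le
  have hβ0 : 0 ≤ β := div_nonneg (sub_nonneg.mpr hr) hd.le
  -- The added `1` keeps the constant nonzero, so that the case `T = ⊤` is trivial.
  refine ⟨(C ^ β) ^ r⁻¹ + 1, fun u hu => ?_⟩
  set T := eLpNorm u (ENNReal.ofReal p) volume + G.gagliardo ν s p u with hTdef
  by_cases hT : T = ⊤
  · rw [hT, ENNReal.mul_top (by simp)]
    exact le_top
  have h1 : ∫⁻ x, ‖u x‖ₑ ^ p ≤ T ^ p := by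
    rw [← eLpNorm_rpow_eq_lintegral u hp]
    exact ENNReal.rpow_le_rpow le_self_add hp.le
  have h2 := hC u hu T hT h1 le_add_self
  have h3 := lintegral_enorm_rpow_interpolate hu hp.le hr hrm.le hpm
  rw [← eLpNorm_rpow_eq_lintegral u hr0] at h3
  have h4 : eLpNorm u (ENNReal.ofReal r) volume ^ r ≤ (C : ℝ≥0∞) ^ β * T ^ r := by
    calc _ ≤ _ := h3
      _ ≤ (T ^ p) ^ ((m - r) / (m - p)) * (C * T ^ m) ^ β := by gcongr
      _ = C ^ β * (T ^ (p * ((m - r) / (m - p))) * T ^ (m * β)) := by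
        rw [ENNReal.mul_rpow_of_nonneg _ _ hβ0, ENNReal.rpow_mul, ENNReal.rpow_mul]
        ring
      _ = _ := by
        rw [← ENNReal.rpow_add_of_nonneg _ _ (by positivity) (by positivity)]
        congr 2
        rw [hβ]
        field_simp
        ring
  calc eLpNorm u (ENNReal.ofReal r) volume
      ≤ ((C : ℝ≥0∞) ^ β * T ^ r) ^ r⁻¹ := (ENNReal.le_rpow_inv_iff hr0).mpr h4
    _ = (((C ^ β) ^ r⁻¹ : ℝ≥0) : ℝ≥0∞) * T := by
      rw [ENNReal.mul_rpow_of_nonneg _ _ (by positivity), ENNReal.rpow_rpow_inv hr0.ne',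
        ENNReal.coe_rpow_of_nonneg _ (by positivity : (0 : ℝ) ≤ r⁻¹),
        ENNReal.coe_rpow_of_nonneg _ hβ0]
    _ ≤ _ := by
      gcongr
      exact_mod_cast le_self_add

end StratifiedLieGroup

/-! ### Averages and completeness. -/

/-- Jensen's inequality, as the comparison of the `L¹` and `L^p` norms for the normalized
probability measure. -/
theorem enorm_average_rpow_le {α : Type*} [MeasurableSpace α] {μ : Measure α} [IsFiniteMeasure μ]
    [NeZero μ] {g : α → ℝ} (hg : AEStronglyMeasurable g μ) {p : ℝ} (hp : 1 ≤ p) :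
    ‖⨍ x, g x ∂μ‖ₑ ^ p ≤ (μ Set.univ)⁻¹ * ∫⁻ x, ‖g x‖ₑ ^ p ∂μ := by
  have hp0 : 0 < p := one_pos.trans_le hp
  have h1 : ‖⨍ x, g x ∂μ‖ₑ ≤ eLpNorm g (ENNReal.ofReal p) ((μ Set.univ)⁻¹ • μ) := by
    rw [average_eq']
    refine (enorm_integral_le_lintegral_enorm _).trans ?_
    rw [← eLpNorm_one_eq_lintegral_enorm]
    exact eLpNorm_le_eLpNorm_of_exponent_le (by simpa using hp)
      (hg.mono_ac Measure.smul_absolutelyContinuous)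
  refine (ENNReal.rpow_le_rpow h1 hp0.le).trans ?_
  rw [eLpNorm_rpow_eq_lintegral g hp0, lintegral_smul_measure, smul_eq_mul]

theorem exists_tendsto_eLpNorm_sub_of_cauchy {α : Type*} [MeasurableSpace α] {μ : Measure α}
    {q : ℝ≥0∞} (hq : 1 ≤ q) {f : ℕ → α → ℝ} (hf : ∀ n, MemLp (f n) q μ)
    (hc : Tendsto (fun n : ℕ × ℕ => eLpNorm (f n.1 - f n.2) q μ) atTop (𝓝 0)) :
    ∃ v : α → ℝ, MemLp v q μ ∧ Tendsto (fun n => eLpNorm (f n - v) q μ) atTop (𝓝 0) := by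
  have : Fact (1 ≤ q) := ⟨hq⟩
  have hcau : CauchySeq fun n => (hf n).toLp (f n) := by
    rw [Lp.cauchySeq_Lp_iff_cauchySeq_eLpNorm]
    refine hc.congr fun n => eLpNorm_congr_ae ?_
    exact ((hf n.1).coeFn_toLp.sub (hf n.2).coeFn_toLp).symm
  obtain ⟨v, hv⟩ := cauchySeq_tendsto_of_complete hcau
  refine ⟨v, Lp.memLp v, ?_⟩
  rw [Lp.tendsto_Lp_iff_tendsto_eLpNorm'] at hv
  refine hv.congr fun n => eLpNorm_congr_ae ?_
  exact (hf n).coeFn_toLp.sub (ae_eq_refl _)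

/-! ### Poincaré inequality and compactness in `L^p`. -/

namespace StratifiedLieGroup

variable {N : ℕ} {G : StratifiedLieGroup N} (ν : G.QuasiNorm)

/-- The fractional Poincaré inequality. -/
theorem exists_eLpNorm_le_gagliardo [Nonempty (Fin N)] {s p : ℝ} (hs : 0 ≤ s) (hp : 0 < p)
    {Ω : Set (Fin N → ℝ)} (hΩ : MeasurableSet Ω) (hb : Bornology.IsBounded Ω) :
    ∃ C : ℝ≥0, ∀ u : (Fin N → ℝ) → ℝ, (∀ᵐ x, x ∉ Ω → u x = 0) →
      eLpNorm u (ENNReal.ofReal p) (volume.restrict Ω) ≤ C * G.gagliardo ν s p u := by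
  obtain ⟨R, hR⟩ := hb.subset_closedBall (0 : Fin N → ℝ)
  -- In the supremum norm this centre has norm `|R| + 2`, so its unit ball misses the ball of radius
  -- `R` containing `Ω`.
  set c : Fin N → ℝ := fun _ => |R| + 2 with hc
  have hcnorm : ‖c‖ = |R| + 2 := by
    rw [hc, pi_norm_const, Real.norm_of_nonneg (by positivity)]
  have hcont : Continuous fun z : (Fin N → ℝ) × (Fin N → ℝ) =>
      ν.toFun (G.mul (G.inv z.1) z.2) := ν.continuous_toFun.comp G.continuous_inv_mul
  obtain ⟨K, hK⟩ := ((isCompact_closedBall (0 : Fin N → ℝ) R).prod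
    (isCompact_closedBall c 1)).bddAbove_image hcont.continuousOn
  set E := Metric.ball c 1 with hE
  have hE0 : volume E ≠ 0 := (Metric.measure_ball_pos _ _ one_pos).ne'
  have hEtop : volume E ≠ ⊤ := measure_ball_lt_top.ne
  have hEΩ : ∀ x ∈ E, x ∉ Ω := by
    intro x hx hxΩ
    have h1 := mem_closedBall_zero_iff.mp (hR hxΩ)
    have h2 : ‖x - c‖ < 1 := mem_ball_iff_norm.mp hx
    have h3 := norm_sub_norm_le c x
    rw [norm_sub_rev, hcnorm] at h3
    have := le_abs_self R
    linarith
  set κ := ENNReal.ofReal (max K 1 ^ ((G.homogeneousDimension : ℝ) + p * s)) with hκ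
  have hD : (volume E)⁻¹ * κ ≠ ⊤ := ENNReal.mul_ne_top (by simpa using hE0) ENNReal.ofReal_ne_top
  have hpinv : 0 ≤ p⁻¹ := inv_nonneg.mpr hp.le
  refine ⟨(((volume E)⁻¹ * κ) ^ p⁻¹).toNNReal, fun u hu => ?_⟩
  have hpt : ∀ y ∈ Ω, ‖u y‖ₑ ^ p ≤ (volume E)⁻¹ * κ * localEnergy ν s p u y := by
    intro y hy
    have h := setLIntegral_enorm_sub_rpow_le_localEnergy ν hs hp u y (A := E) measurableSet_ball
      (K := max K 1) (by positivity) (fun x hx => (hK (Set.mem_image_of_mem _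
        (Set.mk_mem_prod (hR hy) (Metric.ball_subset_closedBall hx)))).trans (le_max_left _ _))
    have heq : ∫⁻ x in E, ‖u x - u y‖ₑ ^ p = ‖u y‖ₑ ^ p * volume E := by
      rw [← setLIntegral_const]
      refine setLIntegral_congr_fun_ae measurableSet_ball ?_
      filter_upwards [hu] with x hx hxE
      rw [hx (hEΩ x hxE), zero_sub, enorm_neg]
    rw [heq, ← hκ] at h
    rw [_root_.mul_assoc, mul_comm, ← div_eq_mul_inv]
    exact (ENNReal.le_div_iff_mul_le (Or.inl hE0) (Or.inl hEtop)).mpr h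
  have hint : eLpNorm u (ENNReal.ofReal p) (volume.restrict Ω) ^ p ≤
      (volume E)⁻¹ * κ * G.gagliardo ν s p u ^ p := by
    rw [eLpNorm_rpow_eq_lintegral u hp, ← lintegral_localEnergy ν hp, ← lintegral_const_mul' _ _ hD]
    exact (setLIntegral_mono' hΩ hpt).trans (setLIntegral_le_lintegral _ _)
  rw [ENNReal.coe_toNNReal (ENNReal.rpow_ne_top_of_nonneg hpinv hD)]
  calc _ ≤ ((volume E)⁻¹ * κ * G.gagliardo ν s p u ^ p) ^ p⁻¹ :=
        (ENNReal.le_rpow_inv_iff hp).mpr hint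
    _ = _ := by rw [ENNReal.mul_rpow_of_nonneg _ _ hpinv, ENNReal.rpow_rpow_inv hp.ne']

/-- Compactness of the closure leaves finitely many boxes. A simple function choosing the centre
makes the box average measurable in `y`, with finitely many values. -/
theorem exists_simpleFunc_mem_unitBox (G : StratifiedLieGroup N) {Ω : Set (Fin N → ℝ)}
    (hb : Bornology.IsBounded Ω) (ρ : ℝ) :
    ∃ c : SimpleFunc (Fin N → ℝ) (Fin N → ℝ), ∀ y ∈ Ω, y ∈ G.unitBox (c y) ρ := by
  obtain ⟨t, -, ht⟩ := hb.isCompact_closure.elim_nhds_subcover (fun c => G.unitBox c ρ)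
    (fun c _ => (G.isOpen_unitBox c ρ).mem_nhds (G.self_mem_unitBox c ρ))
  have key : ∀ t : Finset (Fin N → ℝ), ∃ c : SimpleFunc (Fin N → ℝ) (Fin N → ℝ),
      ∀ y ∈ ⋃ x ∈ t, G.unitBox x ρ, y ∈ G.unitBox (c y) ρ := by
    classical
    intro t
    induction t using Finset.induction_on with
    | empty => exact ⟨SimpleFunc.const _ 0, by simp⟩
    | insert a t _ ih =>
      obtain ⟨c, hc⟩ := ih
      refine ⟨SimpleFunc.piecewise (G.unitBox a ρ) (G.isOpen_unitBox a ρ).measurableSet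
        (SimpleFunc.const _ a) c, fun y hy => ?_⟩
      by_cases hya : y ∈ G.unitBox a ρ
      · simp [hya]
      · rw [Finset.set_biUnion_insert] at hy
        simpa [hya] using hc y (hy.resolve_left hya)
  obtain ⟨c, hc⟩ := key t
  exact ⟨c, fun y hy => hc y (ht (subset_closure hy))⟩

theorem unitBox_restrict_finite_neZero (c : Fin N → ℝ) {ρ : ℝ} (hρ : 0 < ρ) :
    IsFiniteMeasure (volume.restrict (G.unitBox c ρ)) ∧ NeZero (volume.restrict (G.unitBox c ρ)) := by
  have hV : 0 < volume.real (Metric.ball (0 : Fin N → ℝ) 1) := volume_real_ball_pos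
  refine ⟨⟨?_⟩, ⟨?_⟩⟩
  · rw [Measure.restrict_apply_univ, G.volume_unitBox c hρ]
    exact ENNReal.ofReal_lt_top
  · rw [Ne, Measure.restrict_eq_zero, G.volume_unitBox c hρ, ENNReal.ofReal_eq_zero, not_le]
    positivity

/-- By Jensen, the error at `y` to the power `p` is at most the squared kernel scale `(M * ρ) ^
(2Q)` over the box measure `V * ρ ^ Q`, times the local energy. A factor `ρ ^ Q` survives and makes
the error small. -/
theorem exists_simpleFunc_eLpNorm_sub_average_le {s p : ℝ} (hs : 0 < s) (hp : 1 ≤ p)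
    (hQ : p * s = (G.homogeneousDimension : ℝ)) {Ω : Set (Fin N → ℝ)} (hΩ : MeasurableSet Ω)
    (hb : Bornology.IsBounded Ω) (A : ℝ≥0) {ε : ℝ} (hε : 0 < ε) :
    ∃ ρ : ℝ, 0 < ρ ∧ ∃ c : SimpleFunc (Fin N → ℝ) (Fin N → ℝ), ∀ u : (Fin N → ℝ) → ℝ,
      MemLp u (ENNReal.ofReal p) volume → G.gagliardo ν s p u ≤ A →
      eLpNorm (fun y => u y - ⨍ x in G.unitBox (c y) ρ, u x) (ENNReal.ofReal p)
        (volume.restrict Ω) ≤ ENNReal.ofReal ε := by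
  obtain ⟨M, hM, hMν⟩ := ν.exists_bound_unitBox
  have hp0 : 0 < p := one_pos.trans_le hp
  have hV : 0 < volume.real (Metric.ball (0 : Fin N → ℝ) 1) := volume_real_ball_pos
  set V := volume.real (Metric.ball (0 : Fin N → ℝ) 1) with hVdef
  set Q := G.homogeneousDimension with hQdef
  have hQ0 : Q ≠ 0 := by
    have : (0 : ℝ) < Q := hQ ▸ mul_pos hp0 hs
    exact_mod_cast this.ne'
  -- The value of `ρ ^ Q` that makes the final bound exactly `ε ^ p`; `A + 1` avoids a zero
  -- denominator.
  set δ := ε ^ p * V / ((M ^ Q) ^ 2 * ((A : ℝ) + 1) ^ p) with hδ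
  have hδ0 : 0 < δ := by positivity
  set ρ := δ ^ ((Q : ℝ)⁻¹) with hρdef
  have hρ : 0 < ρ := by positivity
  have hρQ : ρ ^ Q = δ := Real.rpow_inv_natCast_pow hδ0.le hQ0
  obtain ⟨c, hc⟩ := G.exists_simpleFunc_mem_unitBox hb ρ
  refine ⟨ρ, hρ, c, fun u hu hA => ?_⟩
  have hvol : ∀ z, volume (G.unitBox z ρ) = ENNReal.ofReal (δ * V) := fun z => by
    rw [G.volume_unitBox z hρ, hρQ]
  have hpt : ∀ y ∈ Ω, ‖u y - ⨍ x in G.unitBox (c y) ρ, u x‖ₑ ^ p ≤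
      ENNReal.ofReal ((M ^ Q) ^ 2 * δ / V) * localEnergy ν s p u y := by
    intro y hy
    have hUm := (G.isOpen_unitBox (c y) ρ).measurableSet
    obtain ⟨hfin, hne⟩ := unitBox_restrict_finite_neZero (G := G) (c y) hρ
    have huint : Integrable u (volume.restrict (G.unitBox (c y) ρ)) :=
      (hu.restrict _).integrable (by simpa using hp)
    have hav : ⨍ x in G.unitBox (c y) ρ, (u x - u y) = (⨍ x in G.unitBox (c y) ρ, u x) - u y := by
      have hne' : volume.real (G.unitBox (c y) ρ) ≠ 0 := by
        rw [Measure.real, hvol, ENNReal.toReal_ofReal (by positivity)]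
        positivity
      rw [average_eq, average_eq, integral_sub huint (integrable_const _), integral_const, smul_sub,
        measureReal_restrict_apply_univ, inv_smul_smul₀ hne']
    have h1 := enorm_average_rpow_le (huint.sub (integrable_const (u y))).aestronglyMeasurable hp
    simp only [Pi.sub_apply] at h1
    rw [hav, ← enorm_neg, neg_sub, Measure.restrict_apply_univ, hvol] at h1
    have h2 := setLIntegral_enorm_sub_rpow_le_localEnergy ν hs.le hp0 u y hUm (mul_pos hM hρ)
      (fun x hx => hMν (c y) ρ hρ x hx y (hc y hy))
    rw [hQ, Real.rpow_add (mul_pos hM hρ), Real.rpow_natCast, ← hQdef, _root_.mul_pow, hρQ,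
      ← sq] at h2
    refine h1.trans ((mul_le_mul_right h2 _).trans (le_of_eq ?_))
    rw [← ENNReal.ofReal_inv_of_pos (by positivity), ← _root_.mul_assoc,
      ← ENNReal.ofReal_mul (by positivity)]
    congr 2
    field_simp
  have hint : eLpNorm (fun y => u y - ⨍ x in G.unitBox (c y) ρ, u x) (ENNReal.ofReal p)
      (volume.restrict Ω) ^ p ≤ ENNReal.ofReal ε ^ p := by
    rw [eLpNorm_rpow_eq_lintegral _ hp0]
    calc _ ≤ _ := setLIntegral_mono' hΩ hpt
      _ ≤ _ := setLIntegral_le_lintegral _ _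
      _ = ENNReal.ofReal ((M ^ Q) ^ 2 * δ / V) * G.gagliardo ν s p u ^ p := by
        rw [lintegral_const_mul' _ _ ENNReal.ofReal_ne_top, lintegral_localEnergy ν hp0]
      _ ≤ ENNReal.ofReal ((M ^ Q) ^ 2 * δ / V) * ENNReal.ofReal ((A : ℝ) + 1) ^ p := by
        gcongr
        refine hA.trans ?_
        rw [← ENNReal.ofReal_coe_nnreal]
        exact ENNReal.ofReal_le_ofReal (by linarith)
      _ = _ := by
        rw [ENNReal.ofReal_rpow_of_pos (by positivity), ENNReal.ofReal_rpow_of_pos hε,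
          ← ENNReal.ofReal_mul (by positivity)]
        congr 1
        rw [hδ]
        field_simp
  exact (ENNReal.rpow_le_rpow_iff hp0).mp hint

theorem exists_subseq_cauchy_eLpNorm {s p : ℝ} (hs : 0 < s) (hp : 1 ≤ p)
    (hQ : p * s = (G.homogeneousDimension : ℝ)) {Ω : Set (Fin N → ℝ)} (hΩ : MeasurableSet Ω)
    (hb : Bornology.IsBounded Ω) (A : ℝ≥0) {u : ℕ → (Fin N → ℝ) → ℝ}
    (hu : ∀ n, MemLp (u n) (ENNReal.ofReal p) volume)
    (huA : ∀ n, eLpNorm (u n) (ENNReal.ofReal p) volume ≤ A)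
    (hgA : ∀ n, G.gagliardo ν s p (u n) ≤ A) :
    ∃ φ : ℕ → ℕ, StrictMono φ ∧ Tendsto (fun n : ℕ × ℕ =>
      eLpNorm (u (φ n.1) - u (φ n.2)) (ENNReal.ofReal p) (volume.restrict Ω)) atTop (𝓝 0) := by
  have hp0 : 0 < p := one_pos.trans_le hp
  have hpE : (1 : ℝ≥0∞) ≤ ENNReal.ofReal p := by simpa using hp
  have happ : ∀ k : ℕ, ∃ ρ : ℝ, 0 < ρ ∧ ∃ c : SimpleFunc (Fin N → ℝ) (Fin N → ℝ), ∀ n,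
      eLpNorm (fun y => u n y - ⨍ x in G.unitBox (c y) ρ, u n x) (ENNReal.ofReal p)
        (volume.restrict Ω) ≤ ENNReal.ofReal (1 / (k + 1)) := fun k => by
    obtain ⟨ρ, hρ, c, h⟩ := exists_simpleFunc_eLpNorm_sub_average_le ν hs hp hQ hΩ hb A
      (ε := 1 / ((k : ℝ) + 1)) (by positivity)
    exact ⟨ρ, hρ, c, fun n => h (u n) (hu n) (hgA n)⟩
  choose ρ hρ c hc using happ
  have hbound : ∀ k, ∃ B : ℝ, 0 ≤ B ∧ ∀ n z, ‖⨍ x in G.unitBox z (ρ k), u n x‖ ≤ B := by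
    intro k
    set D := (volume (G.unitBox 0 (ρ k)))⁻¹ * (A : ℝ≥0∞) ^ p with hD
    have hvol : ∀ z, volume (G.unitBox z (ρ k)) = volume (G.unitBox 0 (ρ k)) := fun z => by
      rw [G.volume_unitBox z (hρ k), G.volume_unitBox 0 (hρ k)]
    have hne0 : volume (G.unitBox 0 (ρ k)) ≠ 0 := fun h =>
      (unitBox_restrict_finite_neZero (G := G) 0 (hρ k)).2.out (Measure.restrict_eq_zero.mpr h)
    have hDtop : D ≠ ⊤ := ENNReal.mul_ne_top (by simpa using hne0)
      (ENNReal.rpow_ne_top_of_nonneg hp0.le ENNReal.coe_ne_top)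
    refine ⟨(D ^ p⁻¹).toReal, ENNReal.toReal_nonneg, fun n z => ?_⟩
    obtain ⟨hfin, hne⟩ := unitBox_restrict_finite_neZero (G := G) z (hρ k)
    have h := enorm_average_rpow_le ((hu n).restrict (G.unitBox z (ρ k))).aestronglyMeasurable hp
    have h2 : ‖⨍ x in G.unitBox z (ρ k), u n x‖ₑ ^ p ≤ D := by
      refine h.trans ?_
      rw [Measure.restrict_apply_univ, hvol, hD]
      gcongr
      refine (setLIntegral_le_lintegral _ _).trans ?_
      rw [← eLpNorm_rpow_eq_lintegral (u n) hp0]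
      exact ENNReal.rpow_le_rpow (huA n) hp0.le
    rw [← toReal_enorm]
    exact ENNReal.toReal_mono (ENNReal.rpow_ne_top_of_nonneg (by positivity) hDtop)
      ((ENNReal.le_rpow_inv_iff hp0).mpr h2)
  choose B hB0 hB using hbound
  set a : ℕ → (k : ℕ) → ((c k).range → ℝ) :=
    fun n k z => ⨍ x in G.unitBox z (ρ k), u n x with ha
  -- Compactness of the countable product of finite-dimensional balls replaces a diagonal
  -- extraction: one subsequence works for all scales `k`.
  obtain ⟨l, -, φ, hφ, hl⟩ := (isCompact_univ_pi fun k =>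
    isCompact_closedBall (0 : (c k).range → ℝ) (B k)).tendsto_subseq (x := a) (fun n k _ => by
      rw [mem_closedBall_zero_iff, pi_norm_le_iff_of_nonneg (hB0 k)]
      exact fun z => hB k n z)
  refine ⟨φ, hφ, ?_⟩
  have htri : ∀ k : ℕ, ∀ n : ℕ × ℕ, eLpNorm (u (φ n.1) - u (φ n.2)) (ENNReal.ofReal p)
      (volume.restrict Ω) ≤ ENNReal.ofReal (1 / (k + 1)) + (ENNReal.ofReal (1 / (k + 1)) +
        volume Ω ^ p⁻¹ * ENNReal.ofReal (dist (a (φ n.1) k) (a (φ n.2) k))) := by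
    intro k n
    set P : ℕ → (Fin N → ℝ) → ℝ := fun i y => ⨍ x in G.unitBox (c k y) (ρ k), u i x with hP
    have hPm : ∀ i, AEStronglyMeasurable (P i) (volume.restrict Ω) := fun i =>
      ((c k).map fun z => ⨍ x in G.unitBox z (ρ k), u i x).aestronglyMeasurable
    have hum : ∀ i, AEStronglyMeasurable (u i) (volume.restrict Ω) := fun i =>
      ((hu i).restrict Ω).aestronglyMeasurable
    have hdiff : u (φ n.1) - u (φ n.2) = (u (φ n.1) - P (φ n.1)) +
        ((P (φ n.2) - u (φ n.2)) + (P (φ n.1) - P (φ n.2))) := by abel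
    rw [hdiff]
    refine (eLpNorm_add_le ((hum _).sub (hPm _)) (((hPm _).sub (hum _)).add ((hPm _).sub (hPm _)))
      hpE).trans (add_le_add (hc k (φ n.1)) ?_)
    refine (eLpNorm_add_le ((hPm _).sub (hum _)) ((hPm _).sub (hPm _)) hpE).trans
      (add_le_add ?_ ?_)
    · rw [eLpNorm_sub_comm]
      exact hc k (φ n.2)
    · have h := eLpNorm_le_of_ae_bound (p := ENNReal.ofReal p) (μ := volume.restrict Ω)
        (f := P (φ n.1) - P (φ n.2)) (C := dist (a (φ n.1) k) (a (φ n.2) k))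
        (ae_of_all _ fun y => by
          rw [Pi.sub_apply, ← dist_eq_norm]
          exact dist_le_pi_dist (a (φ n.1) k) (a (φ n.2) k) ⟨c k y, (c k).mem_range_self y⟩)
      rwa [Measure.restrict_apply_univ, ENNReal.toReal_ofReal hp0.le] at h
  have hdist : ∀ k, Tendsto (fun n : ℕ × ℕ => dist (a (φ n.1) k) (a (φ n.2) k)) atTop (𝓝 0) :=
    fun k => cauchySeq_iff_tendsto_dist_atTop_0.mp ((tendsto_pi_nhds.mp hl k).cauchySeq)
  have hΩtop : volume Ω ^ p⁻¹ ≠ ⊤ :=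
    ENNReal.rpow_ne_top_of_nonneg (by positivity) hb.measure_lt_top.ne
  have hk : Tendsto (fun k : ℕ => ENNReal.ofReal (1 / ((k : ℝ) + 1)) +
      (ENNReal.ofReal (1 / ((k : ℝ) + 1)) + 0)) atTop (𝓝 0) := by
    have h := (ENNReal.continuous_ofReal.tendsto 0).comp
      (tendsto_one_div_add_atTop_nhds_zero_nat (𝕜 := ℝ))
    simpa using h.add h
  rw [ENNReal.tendsto_nhds_zero]
  intro ε hε
  obtain ⟨k, hk⟩ := (hk.eventually (gt_mem_nhds hε)).exists
  have hlim : Tendsto (fun n : ℕ × ℕ => ENNReal.ofReal (1 / ((k : ℝ) + 1)) +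
      (ENNReal.ofReal (1 / (k + 1)) +
        volume Ω ^ p⁻¹ * ENNReal.ofReal (dist (a (φ n.1) k) (a (φ n.2) k)))) atTop
      (𝓝 (ENNReal.ofReal (1 / ((k : ℝ) + 1)) + (ENNReal.ofReal (1 / ((k : ℝ) + 1)) + 0))) := by
    refine tendsto_const_nhds.add (tendsto_const_nhds.add ?_)
    have h := ENNReal.Tendsto.const_mul (a := volume Ω ^ p⁻¹)
      ((ENNReal.continuous_ofReal.tendsto 0).comp (hdist k)) (Or.inr hΩtop)
    simpa using h
  filter_upwards [hlim.eventually (gt_mem_nhds hk)] with n hn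
  exact (htri k n).trans hn.le

end StratifiedLieGroup

/-! ### Changing exponents and norms in embeddings. -/

theorem tendsto_eLpNorm_of_tendsto_of_bounded {α ι : Type*} [MeasurableSpace α] {μ : Measure α}
    {l : Filter ι} {w : ι → α → ℝ} (hw : ∀ i, AEMeasurable (w i) μ) {p r m : ℝ} (hp : 0 < p)
    (hpr : p ≤ r) (hrm : r < m) {B : ℝ≥0∞} (hB : B ≠ ⊤)
    (hm : ∀ i, eLpNorm (w i) (ENNReal.ofReal m) μ ≤ B)
    (h : Tendsto (fun i => eLpNorm (w i) (ENNReal.ofReal p) μ) l (𝓝 0)) :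
    Tendsto (fun i => eLpNorm (w i) (ENNReal.ofReal r) μ) l (𝓝 0) := by
  have hr : 0 < r := hp.trans_le hpr
  have hpm : p < m := hpr.trans_lt hrm
  have hm0 : 0 < m := hp.trans hpm
  set α' := (m - r) / (m - p) with hα'
  set β := (r - p) / (m - p) with hβ
  -- Strict positivity, from `r < m`, makes the factor tending to zero count.
  have hα0 : 0 < α' := div_pos (sub_pos.mpr hrm) (sub_pos.mpr hpm)
  have hβ0 : 0 ≤ β := div_nonneg (sub_nonneg.mpr hpr) (sub_pos.mpr hpm).le
  have hle : ∀ i, eLpNorm (w i) (ENNReal.ofReal r) μ ≤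
      ((eLpNorm (w i) (ENNReal.ofReal p) μ ^ p) ^ α' * (B ^ m) ^ β) ^ r⁻¹ := fun i => by
    rw [ENNReal.le_rpow_inv_iff hr, eLpNorm_rpow_eq_lintegral _ hr,
      eLpNorm_rpow_eq_lintegral _ hp]
    refine (lintegral_enorm_rpow_interpolate (hw i) hp.le hpr hrm.le hpm).trans ?_
    gcongr
    rw [← eLpNorm_rpow_eq_lintegral _ hm0]
    exact ENNReal.rpow_le_rpow (hm i) hm0.le
  refine tendsto_of_tendsto_of_tendsto_of_le_of_le tendsto_const_nhds ?_ (fun _ => zero_le) hle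
  have h1 := ((h.ennrpow_const p).ennrpow_const α')
  have h2 := (ENNReal.Tendsto.mul_const h1 (b := (B ^ m) ^ β) (Or.inr
    (ENNReal.rpow_ne_top_of_nonneg hβ0 (ENNReal.rpow_ne_top_of_nonneg hm0.le hB)))).ennrpow_const r⁻¹
  rwa [ENNReal.zero_rpow_of_pos hp, ENNReal.zero_rpow_of_pos hα0, zero_mul,
    ENNReal.zero_rpow_of_pos (inv_pos.mpr hr)] at h2

section Embeddings

variable {N : ℕ} {X : Set ((Fin N → ℝ) → ℝ)} {nrm nrm' : ((Fin N → ℝ) → ℝ) → ℝ≥0∞} {r q : ℝ}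
  {Ω : Set (Fin N → ℝ)}

theorem ContinuouslyEmbedsInLp.of_norm_le (h : ContinuouslyEmbedsInLp X nrm r Ω) {K : ℝ≥0}
    (hK : ∀ u ∈ X, nrm u ≤ K * nrm' u) : ContinuouslyEmbedsInLp X nrm' r Ω := by
  obtain ⟨C, -, h⟩ := h
  refine ⟨C * K + 1, by positivity, fun u hu => ⟨(h u hu).1, (h u hu).2.trans ?_⟩⟩
  calc C * nrm u ≤ C * (K * nrm' u) := by
        gcongr
        exact hK u hu
    _ = (C * K : ℝ≥0) * nrm' u := by
        push_cast
        ring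
    _ ≤ _ := by
        gcongr
        exact le_self_add

theorem CompactlyEmbedsInLp.of_norm_le (h : CompactlyEmbedsInLp X nrm r Ω) {K : ℝ≥0}
    (hK : ∀ u ∈ X, nrm u ≤ K * nrm' u) : CompactlyEmbedsInLp X nrm' r Ω := by
  refine ⟨h.1.of_norm_le hK, fun u hu ⟨M, hM⟩ => h.2 u hu ⟨K * M, fun n => ?_⟩⟩
  calc nrm (u n) ≤ K * nrm' (u n) := hK _ (hu n)
    _ ≤ K * M := by
        gcongr
        exact hM n
    _ = _ := (ENNReal.coe_mul _ _).symm

theorem eLpNorm_restrict_le_mul_of_exponent_le (hr : 1 ≤ r) (hrq : r ≤ q)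
    (hΩ : volume Ω ≠ ⊤) :
    ∃ D : ℝ≥0, ∀ u : (Fin N → ℝ) → ℝ, AEStronglyMeasurable u (volume.restrict Ω) →
      eLpNorm u (ENNReal.ofReal r) (volume.restrict Ω) ≤
        D * eLpNorm u (ENNReal.ofReal q) (volume.restrict Ω) := by
  have hr0 : 0 < r := one_pos.trans_le hr
  have hexp : 0 ≤ 1 / r - 1 / q := sub_nonneg.mpr (one_div_le_one_div_of_le hr0 hrq)
  refine ⟨(volume Ω ^ (1 / r - 1 / q)).toNNReal, fun u hu => ?_⟩
  have h := eLpNorm_le_eLpNorm_mul_rpow_measure_univ (ENNReal.ofReal_le_ofReal hrq) hu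
  rw [Measure.restrict_apply_univ, ENNReal.toReal_ofReal hr0.le,
    ENNReal.toReal_ofReal (hr0.le.trans hrq)] at h
  rwa [ENNReal.coe_toNNReal (ENNReal.rpow_ne_top_of_nonneg hexp hΩ), mul_comm]

theorem CompactlyEmbedsInLp.of_exponent_le (h : CompactlyEmbedsInLp X nrm q Ω) (hr : 1 ≤ r)
    (hrq : r ≤ q) (hΩ : volume Ω ≠ ⊤) : CompactlyEmbedsInLp X nrm r Ω := by
  have : IsFiniteMeasure (volume.restrict Ω) := ⟨by simpa using hΩ.lt_top⟩
  obtain ⟨D, hD⟩ := eLpNorm_restrict_le_mul_of_exponent_le hr hrq hΩ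
  have hexp := ENNReal.ofReal_le_ofReal hrq
  obtain ⟨⟨C, -, hC⟩, hcomp⟩ := h
  refine ⟨⟨D * C + 1, by positivity, fun u hu => ⟨(hC u hu).1.mono_exponent hexp, ?_⟩⟩,
    fun u hu hM => ?_⟩
  · calc _ ≤ _ := hD u (hC u hu).1.aestronglyMeasurable
      _ ≤ D * (C * nrm u) := by
          gcongr
          exact (hC u hu).2
      _ = (D * C : ℝ≥0) * nrm u := by
          push_cast
          ring
      _ ≤ _ := by
          gcongr
          exact le_self_add
  · obtain ⟨v, hv, φ, hφ, hlim⟩ := hcomp u hu hM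
    refine ⟨v, hv.mono_exponent hexp, φ, hφ, ?_⟩
    have h2 := ENNReal.Tendsto.const_mul (a := (D : ℝ≥0∞)) hlim (Or.inr ENNReal.coe_ne_top)
    rw [mul_zero] at h2
    exact tendsto_of_tendsto_of_tendsto_of_le_of_le tendsto_const_nhds h2 (fun _ => zero_le)
      fun n => hD _ ((hC _ (hu _)).1.sub hv).aestronglyMeasurable

end Embeddings

/-! ### The embeddings of `X_0^{s,p}(Ω)`. -/

namespace StratifiedLieGroup

variable {N : ℕ} {G : StratifiedLieGroup N} (ν : G.QuasiNorm) {s p r : ℝ} {Ω : Set (Fin N → ℝ)}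

theorem eLpNorm_eq_of_mem_spaceXZero (hΩ : MeasurableSet Ω) {u : (Fin N → ℝ) → ℝ}
    (hu : u ∈ G.spaceXZero ν s p Ω) (q : ℝ≥0∞) :
    eLpNorm u q (volume.restrict Ω) = eLpNorm u q volume := by
  rw [← eLpNorm_indicator_eq_eLpNorm_restrict hΩ]
  refine eLpNorm_congr_ae ?_
  filter_upwards [hu.2] with x hx
  by_cases hxΩ : x ∈ Ω
  · simp [hxΩ]
  · simp [hxΩ, hx hxΩ]

theorem normXZero_lt_top {u : (Fin N → ℝ) → ℝ} (hu : u ∈ G.spaceXZero ν s p Ω) :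
    G.normXZero ν s p Ω u < ⊤ :=
  ENNReal.add_lt_top.mpr ⟨(hu.1.1.restrict Ω).eLpNorm_lt_top, hu.1.2⟩

theorem exists_eLpNorm_le_normXZero (hs : 0 < s) (hp : 0 < p)
    (hQ : p * s = (G.homogeneousDimension : ℝ)) (hr : p ≤ r) (hΩ : MeasurableSet Ω) :
    ∃ C : ℝ≥0, ∀ u ∈ G.spaceXZero ν s p Ω,
      eLpNorm u (ENNReal.ofReal r) volume ≤ C * G.normXZero ν s p Ω u := by
  obtain ⟨C, hC⟩ := exists_eLpNorm_le ν hs hp hQ hr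
  refine ⟨C, fun u hu => ?_⟩
  rw [normXZero, eLpNorm_eq_of_mem_spaceXZero ν hΩ hu]
  exact hC u hu.1.1.aestronglyMeasurable.aemeasurable

theorem continuouslyEmbedsInLp_spaceXZero (hs : 0 < s) (hp : 0 < p)
    (hQ : p * s = (G.homogeneousDimension : ℝ)) (hr : p ≤ r) (hΩ : MeasurableSet Ω) :
    ContinuouslyEmbedsInLp (G.spaceXZero ν s p Ω) (G.normXZero ν s p Ω) r Ω := by
  obtain ⟨C, hC⟩ := exists_eLpNorm_le_normXZero ν hs hp hQ hr hΩ
  refine ⟨C + 1, by positivity, fun u hu => ?_⟩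
  have hle : eLpNorm u (ENNReal.ofReal r) (volume.restrict Ω) ≤
      (C + 1 : ℝ≥0) * G.normXZero ν s p Ω u := by
    rw [eLpNorm_eq_of_mem_spaceXZero ν hΩ hu]
    refine (hC u hu).trans ?_
    gcongr
    exact le_self_add
  exact ⟨⟨hu.1.1.aestronglyMeasurable.restrict,
    hle.trans_lt (ENNReal.mul_lt_top ENNReal.coe_lt_top (normXZero_lt_top ν hu))⟩, hle⟩

theorem compactlyEmbedsInLp_spaceXZero (hs : 0 < s) (hp : 1 ≤ p)
    (hQ : p * s = (G.homogeneousDimension : ℝ)) (hr : p ≤ r) (hΩ : MeasurableSet Ω)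
    (hb : Bornology.IsBounded Ω) :
    CompactlyEmbedsInLp (G.spaceXZero ν s p Ω) (G.normXZero ν s p Ω) r Ω := by
  have hp0 : 0 < p := one_pos.trans_le hp
  have hcont := continuouslyEmbedsInLp_spaceXZero ν hs hp0 hQ hr hΩ
  refine ⟨hcont, fun u hu ⟨M, hM⟩ => ?_⟩
  obtain ⟨φ, hφ, hcau⟩ := exists_subseq_cauchy_eLpNorm ν hs hp hQ hΩ hb M
    (fun n => (hu n).1.1)
    (fun n => by
      rw [← eLpNorm_eq_of_mem_spaceXZero ν hΩ (hu n)]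
      exact le_self_add.trans (hM n))
    (fun n => le_add_self.trans (hM n))
  -- Any exponent above `r` would do: boundedness there upgrades `L^p` convergence to `L^r`.
  obtain ⟨C, hC⟩ := exists_eLpNorm_le_normXZero ν hs hp0 hQ (hr.trans (le_add_of_nonneg_right
    zero_le_one) : p ≤ r + 1) hΩ
  have hum : ∀ n, AEStronglyMeasurable (u n) (volume.restrict Ω) := fun n =>
    (hu n).1.1.aestronglyMeasurable.restrict
  have hCM : ∀ n, eLpNorm (u n) (ENNReal.ofReal (r + 1)) (volume.restrict Ω) ≤ C * M := fun n =>
    (eLpNorm_restrict_le _ _ _ _).trans ((hC _ (hu n)).trans (by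
      gcongr
      exact hM n))
  have hcau' := tendsto_eLpNorm_of_tendsto_of_bounded (m := r + 1) (B := C * M + C * M)
    (fun n : ℕ × ℕ => ((hum (φ n.1)).sub (hum (φ n.2))).aemeasurable) hp0 hr (lt_add_one r)
    (by finiteness)
    (fun n => (eLpNorm_sub_le (hum _) (hum _)
      (by simpa using hp.trans (hr.trans (lt_add_one r).le))).trans
        (add_le_add (hCM _) (hCM _))) hcau
  obtain ⟨C', -, hC'⟩ := hcont
  obtain ⟨v, hv, hlim⟩ := exists_tendsto_eLpNorm_sub_of_cauchy (f := fun n => u (φ n))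
    (by simpa using hp.trans hr) (fun n => (hC' _ (hu (φ n))).1) hcau'
  exact ⟨v, hv, φ, hφ, hlim⟩

end StratifiedLieGroup

theorem theorem1p2 {N : ℕ} (G : StratifiedLieGroup N) (ν : G.QuasiNorm)
    (Ω : Set (Fin N → ℝ)) (hΩ : IsOpen Ω) (s p : ℝ) (hs0 : 0 < s) (hs1 : s < 1) (hp : 1 ≤ p)
    (hQ : p * s = (G.homogeneousDimension : ℝ)) :
    (∀ r : ℝ, p ≤ r →
      ContinuouslyEmbedsInLp (G.spaceXZero ν s p Ω) (G.normXZero ν s p Ω) r Ω) ∧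
    (Bornology.IsBounded Ω → ∀ r : ℝ, 1 ≤ r →
      CompactlyEmbedsInLp (G.spaceXZero ν s p Ω) (G.normXZero ν s p Ω) r Ω ∧
      CompactlyEmbedsInLp (G.spaceXZero ν s p Ω) (G.gagliardo ν s p) r Ω) := by
  have hp0 : 0 < p := one_pos.trans_le hp
  refine ⟨fun r hr => StratifiedLieGroup.continuouslyEmbedsInLp_spaceXZero ν hs0 hp0 hQ hr hΩ.measurableSet,
    fun hb r hr => ?_⟩
  have hfull : CompactlyEmbedsInLp (G.spaceXZero ν s p Ω) (G.normXZero ν s p Ω) r Ω :=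
    -- Exponents below `p` are reached from `max r p`, since `Ω` has finite measure.
    (StratifiedLieGroup.compactlyEmbedsInLp_spaceXZero ν hs0 hp hQ (le_max_right r p)
      hΩ.measurableSet hb).of_exponent_le hr (le_max_left r p) hb.measure_lt_top.ne
  -- In dimension zero there is no room outside `Ω`; this is excluded by `Q = p * s > 0`.
  have hN : Nonempty (Fin N) := by
    by_contra h
    rw [not_nonempty_iff] at h
    have hpos := mul_pos hp0 hs0
    rw [hQ, StratifiedLieGroup.homogeneousDimension, Finset.univ_eq_empty,
      Finset.sum_empty, Nat.cast_zero] at hpos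
    exact lt_irrefl _ hpos
  obtain ⟨C, hC⟩ := StratifiedLieGroup.exists_eLpNorm_le_gagliardo ν hs0.le hp0
    hΩ.measurableSet hb
  refine ⟨hfull, hfull.of_norm_le (K := C + 1) fun u hu => ?_⟩
  rw [StratifiedLieGroup.normXZero, ENNReal.coe_add, ENNReal.coe_one, add_mul, one_mul]
  exact add_le_add_left (hC u hu.2) _
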